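/- Let $\alpha\in(0,1)$ and, for $f:[0,t]\to\mathbb{R}$ continuous on $[0,t]$ and differentiable on $(0,t)$ with $\tau\mapsto \dot f(\tau)(t-\tau)^{-\alpha}$ integrable on $(0,t)$, let $$ {}^C\!D^\alpha_{0,+}f(t):=\frac{1}{\Gamma(1-\alpha)}\int_0^t\frac{\dot f(\tau)}{(t-\tau)^\alpha}\,d\tau $$ be its left Caputo derivative of order $\alpha$. Then there exist a finite time $T_\star>0$, a function $u_0\in C^\infty(\mathbb{R})$, a function $u:\mathbb{R}\times[0,T_\star)\to\mathbb{R}$, a function $v:[0,T_\star)\to\mathbb{R}$ and a strictly increasing sequence $t_n\in(0,T_\star)$ with $t_n\nearrow T_\star$ such that the following hold. (i) $u$ is a smooth solution of the time-fractional Burgers equation: $u$ is $C^\infty$ on $\mathbb{R}\times(0,T_\star)$; $u$ and all its derivatives $\partial_x^k u$ are continuous on $\mathbb{R}\times[0,T_\star)$; for every $x\in\mathbb{R}$ and $t\in(0,T_\star)$ the Caputo derivative ${}^C\!D^\alpha_{0,+}u(x,t)$ of $u(x,\cdot)$ is well defined as above and $${}^C\!D^\alpha_{0,+}u(x,t)+u(x,t)\,\partial_xu(x,t)=0;$$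 and $u(x,0)=u_0(x)$ for all $x\in\mathbb{R}$. (ii) $u(x,t)=-x\,v(t)$ for all $x\in\mathbb{R}$ and $t\in[0,T_\star)$, where $v(0)=1$ and, for every $t\in(0,T_\star)$, ${}^C\!D^\alpha_{0,+}v(t)$ is well defined as above and equals $v(t)^2$. (iii) $$\lim_{n\to+\infty}u(x,t_n)=\begin{cases}+\infty&\text{if }x<0,\\-\infty&\text{if }x>0.\end{cases}$$ -/

import Mathlib

open Set Filter Topology MeasureTheory
open scoped ContDiff

/-- The integrand `f'(τ) / (t - τ)^α` of the left Caputo derivative at time `t`. -/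
noncomputable def caputoIntegrand (α : ℝ) (f : ℝ → ℝ) (t τ : ℝ) : ℝ :=
  deriv f τ / (t - τ) ^ α

/-- The left Caputo derivative of order `α` with initial time `t₀`, at time `t`:
`(1 / Γ(1 - α)) ∫_{t₀}^t f'(τ) / (t - τ)^α dτ`. -/
noncomputable def caputoDeriv (α t₀ : ℝ) (f : ℝ → ℝ) (t : ℝ) : ℝ :=
  1 / Real.Gamma (1 - α) * ∫ τ in t₀..t, caputoIntegrand α f t τ

/-- The left Caputo derivative of `f` at `t` is meaningful: `f` is continuous on `[t₀, t]`,
differentiable on `(t₀, t)`, and the defining integral converges absolutely. (For `0 < α < 1`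
this makes `f` the integral of `f'` on `[t₀, t]`.) -/
structure CaputoDifferentiableAt (α t₀ : ℝ) (f : ℝ → ℝ) (t : ℝ) : Prop where
  continuousOn : ContinuousOn f (Icc t₀ t)
  differentiableOn : DifferentiableOn ℝ f (Ioo t₀ t)
  integrable : IntervalIntegrable (caputoIntegrand α f t) volume t₀ t

/-- `v` solves `D^α v = v²` on `(0, T)` with `v(0) = 1`. Only the values of `v` on `[0, T)`
matter. -/
structure SolvesCaputoODE (α T : ℝ) (v : ℝ → ℝ) : Prop where
  init : v 0 = 1
  caputo : ∀ t ∈ Ioo 0 T, CaputoDifferentiableAt α 0 v t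
  eqn : ∀ t ∈ Ioo 0 T, caputoDeriv α 0 v t = v t ^ 2

/-- `u` is a smooth solution on `ℝ × [0, T)` of the time-fractional Burgers equation
`D^α u + u ∂ₓu = 0` with initial datum `u₀`. Smooth means: `C^∞` in `(x, t)` on `ℝ × (0, T)`,
with `u` and all its `x`-derivatives continuous on `ℝ × [0, T)`, up to the initial time. -/
structure IsSmoothFractionalBurgersSolution (α T : ℝ) (u₀ : ℝ → ℝ) (u : ℝ → ℝ → ℝ) : Prop where
  smooth : ContDiffOn ℝ ∞ (fun p : ℝ × ℝ => u p.1 p.2) (univ ×ˢ Ioo 0 T)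
  continuous_derivs : ∀ k : ℕ,
    ContinuousOn (fun p : ℝ × ℝ => iteratedDeriv k (fun y => u y p.2) p.1) (univ ×ˢ Ico 0 T)
  caputo : ∀ x : ℝ, ∀ t ∈ Ioo 0 T, CaputoDifferentiableAt α 0 (u x) t
  eqn : ∀ x : ℝ, ∀ t ∈ Ioo 0 T,
    caputoDeriv α 0 (u x) t + u x t * deriv (fun y => u y t) x = 0
  init : ∀ x : ℝ, u x 0 = u₀ x

/-- The ratio `Γ(nα + 1) / Γ((n + 1)α + 1)`. -/
noncomputable def gammaRatio (α : ℝ) (n : ℕ) : ℝ :=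
  Real.Gamma (n * α + 1) / Real.Gamma ((n + 1 : ℕ) * α + 1)

/-- Coefficients of the solution `∑ aₙ t^(nα)` of `D^α v = v²`, `v(0) = 1`. -/
noncomputable def fracCoeff (α : ℝ) : ℕ → ℝ
  | 0 => 1
  | n + 1 => gammaRatio α n *
      ∑ i : Fin (n + 1), fracCoeff α i * fracCoeff α (n - i)
  decreasing_by all_goals omega

theorem fracCoeff_zero (α : ℝ) : fracCoeff α 0 = 1 := by rw [fracCoeff]

theorem fracCoeff_succ (α : ℝ) (n : ℕ) : fracCoeff α (n + 1) =
    gammaRatio α n * ∑ k ∈ Finset.range (n + 1), fracCoeff α k * fracCoeff α (n - k) := by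
  rw [fracCoeff,
    Fin.sum_univ_eq_sum_range fun k => fracCoeff α k * fracCoeff α (n - k)]

theorem gammaRatio_pos {α : ℝ} (hα : 0 < α) (n : ℕ) : 0 < gammaRatio α n :=
  div_pos (Real.Gamma_pos_of_pos (by positivity)) (Real.Gamma_pos_of_pos (by positivity))

theorem Gamma_add_le_mul_Gamma {x a : ℝ} (hx : 0 < x) (ha : a ∈ Ioo (0 : ℝ) 1) :
    Real.Gamma (x + a) ≤ x ^ a * Real.Gamma x := by
  have h := Real.Gamma_mul_add_mul_le_rpow_Gamma_mul_rpow_Gamma (s := x) (t := x + 1) hx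
    (by linarith) (a := 1 - a) (b := a) (by linarith [ha.2]) ha.1 (by ring)
  have hG := Real.Gamma_pos_of_pos hx
  rw [show (1 - a) * x + a * (x + 1) = x + a by ring, Real.Gamma_add_one hx.ne',
    Real.mul_rpow hx.le hG.le] at h
  calc Real.Gamma (x + a) ≤ _ := h
    _ = x ^ a * (Real.Gamma x ^ (1 - a) * Real.Gamma x ^ a) := by ring
    _ = x ^ a * Real.Gamma x := by rw [← Real.rpow_add hG]; simp

theorem inv_succ_le_gammaRatio {α : ℝ} (hα : α ∈ Ioo (0 : ℝ) 1) (n : ℕ) :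
    1 / ((n : ℝ) + 1) ≤ gammaRatio α n := by
  have h0 := hα.1
  have hx : (0 : ℝ) < n * α + 1 := by positivity
  have hG := Real.Gamma_pos_of_pos hx
  have h := Gamma_add_le_mul_Gamma hx hα
  have hp : ((n : ℝ) * α + 1) ^ α ≤ n + 1 := by
    calc ((n : ℝ) * α + 1) ^ α ≤ ((n : ℝ) * α + 1) ^ (1 : ℝ) :=
          Real.rpow_le_rpow_of_exponent_le (by linarith [mul_nonneg (Nat.cast_nonneg (α := ℝ) n) h0.le]) hα.2.le
      _ = n * α + 1 := Real.rpow_one _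
      _ ≤ n + 1 := by nlinarith [hα.2, (Nat.cast_nonneg n : (0 : ℝ) ≤ n)]
  rw [gammaRatio, show ((n + 1 : ℕ) : ℝ) * α + 1 = n * α + 1 + α by push_cast; ring,
    div_le_div_iff₀ (by positivity) (Real.Gamma_pos_of_pos (by positivity))]
  nlinarith

theorem one_le_fracCoeff {α : ℝ} (hα : α ∈ Ioo (0 : ℝ) 1) (n : ℕ) : 1 ≤ fracCoeff α n := by
  induction n using Nat.strong_induction_on with
  | _ n ih =>
    cases n with
    | zero => rw [fracCoeff_zero]
    | succ n =>
      rw [fracCoeff_succ]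
      have hs : ((n : ℝ) + 1) ≤
          ∑ k ∈ Finset.range (n + 1), fracCoeff α k * fracCoeff α (n - k) := by
        calc ((n : ℝ) + 1) = ∑ k ∈ Finset.range (n + 1), (1 : ℝ) := by simp
          _ ≤ _ := Finset.sum_le_sum fun k hk => by
            have := Finset.mem_range.1 hk
            exact one_le_mul_of_one_le_of_one_le (ih _ (by omega)) (ih _ (by omega))
      calc (1 : ℝ) = 1 / ((n : ℝ) + 1) * (n + 1) := by field_simp
        _ ≤ _ := mul_le_mul (inv_succ_le_gammaRatio hα n) hs (by positivity)
          (gammaRatio_pos hα.1 n).le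

theorem fracCoeff_pos {α : ℝ} (hα : α ∈ Ioo (0 : ℝ) 1) (n : ℕ) : 0 < fracCoeff α n :=
  one_pos.trans_le (one_le_fracCoeff hα n)

theorem tendsto_gammaRatio {α : ℝ} (hα : α ∈ Ioo (0 : ℝ) 1) :
    Tendsto (gammaRatio α) atTop (𝓝 0) := by
  have h0 := hα.1
  have h1 := hα.2
  have key : ∀ n : ℕ, gammaRatio α n ≤ 2 * ((n : ℝ) * α + 1) ^ (-α) := fun n => by
    have hx1 : (1 : ℝ) ≤ n * α + 1 := by
      have : 0 ≤ (n : ℝ) * α := by positivity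
      linarith
    rw [gammaRatio, show ((n + 1 : ℕ) : ℝ) * α + 1 = n * α + 1 + α by push_cast; ring]
    generalize (n : ℝ) * α + 1 = x at hx1
    have hx : 0 < x := by linarith
    have h := Gamma_add_le_mul_Gamma (x := x + α) (a := 1 - α) (by positivity)
      ⟨by linarith, by linarith⟩
    rw [show x + α + (1 - α) = x + 1 by ring, Real.Gamma_add_one hx.ne'] at h
    rw [div_le_iff₀ (Real.Gamma_pos_of_pos (by positivity))]
    have hG := Real.Gamma_pos_of_pos (add_pos hx h0)
    have hb : (x + α) ^ (1 - α) ≤ 2 * x ^ (1 - α) := by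
      calc (x + α) ^ (1 - α) ≤ (2 * x) ^ (1 - α) :=
            Real.rpow_le_rpow (by positivity) (by linarith) (by linarith)
        _ = 2 ^ (1 - α) * x ^ (1 - α) := Real.mul_rpow (by norm_num) hx.le
        _ ≤ 2 ^ (1 : ℝ) * x ^ (1 - α) := by
            gcongr
            · norm_num
            · linarith
        _ = _ := by rw [Real.rpow_one]
    have hxx : x ^ (1 - α) = x * x ^ (-α) := by
      rw [sub_eq_add_neg, Real.rpow_add hx, Real.rpow_one]
    rw [hxx] at hb
    refine le_of_mul_le_mul_left (h.trans ?_) hx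
    calc _ ≤ 2 * (x * x ^ (-α)) * Real.Gamma (x + α) := by gcongr
      _ = _ := by ring
  refine squeeze_zero (fun n => (gammaRatio_pos h0 n).le) key ?_
  have hl : Tendsto (fun n : ℕ => (n : ℝ) * α + 1) atTop atTop :=
    tendsto_atTop_add_const_right _ _ (tendsto_natCast_atTop_atTop.atTop_mul_const h0)
  simpa using ((tendsto_rpow_neg_atTop h0).comp hl).const_mul 2

theorem sum_range_convolution_le {b : ℕ → ℝ} (hb : ∀ n, 0 ≤ b n) (N : ℕ) :
    ∑ m ∈ Finset.range N, ∑ k ∈ Finset.range (m + 1), b k * b (m - k) ≤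
      (∑ m ∈ Finset.range N, b m) ^ 2 := by
  rw [Finset.sum_range_diag_flip N fun i j => b i * b j, sq, Finset.sum_mul_sum]
  refine Finset.sum_le_sum fun i _ => Finset.sum_le_sum_of_subset_of_nonneg ?_ ?_
  · intro k hk
    simp only [Finset.mem_range] at hk ⊢
    omega
  · intro k _ _
    exact mul_nonneg (hb _) (hb _)

theorem fracCoeff_mul_pow_succ (α r : ℝ) (n : ℕ) : fracCoeff α (n + 1) * r ^ (n + 1) =
    r * gammaRatio α n * ∑ k ∈ Finset.range (n + 1),
      (fracCoeff α k * r ^ k) * (fracCoeff α (n - k) * r ^ (n - k)) := by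
  rw [fracCoeff_succ, Finset.mul_sum, Finset.mul_sum, Finset.sum_mul]
  refine Finset.sum_congr rfl fun k hk => ?_
  have : k + (n - k) = n := by have := Finset.mem_range.1 hk; omega
  rw [pow_succ, ← this, pow_add, this]
  ring

/-- The set of radii at which the series converges is open to the right. -/
theorem exists_gt_summable {α : ℝ} (hα : α ∈ Ioo (0 : ℝ) 1) {R : ℝ} (hR : 0 ≤ R)
    (hs : Summable fun n => fracCoeff α n * R ^ n) :
    ∃ r, R < r ∧ Summable fun n => fracCoeff α n * r ^ n := by
  set M := ∑' n, fracCoeff α n * R ^ n with hM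
  have hM0 : 0 ≤ M := tsum_nonneg fun n => mul_nonneg (fracCoeff_pos hα n).le (pow_nonneg hR n)
  set δ := 1 / ((R + 1) * (M + 2) ^ 2) with hδ
  have hδ0 : 0 < δ := by positivity
  obtain ⟨n₀, hn₀⟩ := eventually_atTop.1 ((tendsto_gammaRatio hα).eventually (gt_mem_nhds hδ0))
  have hcont : Continuous fun r : ℝ => ∑ n ∈ Finset.range (n₀ + 1), fracCoeff α n * r ^ n := by
    fun_prop
  have hlt : ∑ n ∈ Finset.range (n₀ + 1), fracCoeff α n * R ^ n < M + 1 :=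
    (hs.sum_le_tsum _ fun n _ => mul_nonneg (fracCoeff_pos hα n).le (pow_nonneg hR n)).trans_lt
      (by linarith)
  have hev : ∀ᶠ r in 𝓝[>] R, (∑ n ∈ Finset.range (n₀ + 1), fracCoeff α n * r ^ n < M + 1) ∧
      r < R + 1 ∧ R < r :=
    ((hcont.continuousAt.eventually (gt_mem_nhds hlt)).filter_mono nhdsWithin_le_nhds).and
      (((gt_mem_nhds (lt_add_one R)).filter_mono nhdsWithin_le_nhds).and self_mem_nhdsWithin)
  obtain ⟨r, hr1, hr2, hr3⟩ := hev.exists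
  have hr0 : 0 < r := hR.trans_lt hr3
  have hb : ∀ n, 0 ≤ fracCoeff α n * r ^ n := fun n =>
    mul_nonneg (fracCoeff_pos hα n).le (pow_nonneg hr0.le n)
  refine ⟨r, hr3, summable_of_sum_range_le (c := M + 2) hb fun N => ?_⟩
  induction N with
  | zero => simp; linarith
  | succ N ih =>
    set b : ℕ → ℝ := fun n => fracCoeff α n * r ^ n with hbdef
    have hterm : ∀ m, b (m + 1) ≤ (if m < n₀ then b (m + 1) else 0) +
        r * δ * ∑ k ∈ Finset.range (m + 1), b k * b (m - k) := fun m => by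
      have hc : 0 ≤ ∑ k ∈ Finset.range (m + 1), b k * b (m - k) :=
        Finset.sum_nonneg fun k _ => mul_nonneg (hb _) (hb _)
      split_ifs with h
      · have : 0 ≤ r * δ * ∑ k ∈ Finset.range (m + 1), b k * b (m - k) := by positivity
        linarith
      · rw [zero_add]
        calc b (m + 1) = r * gammaRatio α m * ∑ k ∈ Finset.range (m + 1), b k * b (m - k) :=
              fracCoeff_mul_pow_succ α r m
          _ ≤ _ := by
              gcongr
              exact (hn₀ m (not_lt.1 h)).le
    have hsmall : ∑ m ∈ Finset.range N, (if m < n₀ then b (m + 1) else 0) ≤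
        ∑ m ∈ Finset.range n₀, b (m + 1) := by
      rw [← Finset.sum_filter]
      refine Finset.sum_le_sum_of_subset_of_nonneg ?_ fun k _ _ => hb _
      intro k hk
      simp only [Finset.mem_filter, Finset.mem_range] at hk ⊢
      exact hk.2
    have hS0 : 0 ≤ ∑ m ∈ Finset.range N, b m := Finset.sum_nonneg fun m _ => hb m
    have hlarge : r * δ * (∑ m ∈ Finset.range N, b m) ^ 2 ≤ 1 := by
      calc r * δ * (∑ m ∈ Finset.range N, b m) ^ 2 ≤ (R + 1) * δ * (M + 2) ^ 2 := by gcongr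
        _ = 1 := by rw [hδ]; field_simp
    have hle := Finset.sum_le_sum (s := Finset.range N) fun m _ => hterm m
    rw [Finset.sum_add_distrib, ← Finset.mul_sum] at hle
    have hconv := mul_le_mul_of_nonneg_left (sum_range_convolution_le hb N)
      (mul_nonneg hr0.le hδ0.le)
    rw [Finset.sum_range_succ'] at hr1 ⊢
    change ∑ m ∈ Finset.range n₀, b (m + 1) + b 0 < M + 1 at hr1
    change ∑ m ∈ Finset.range N, b (m + 1) + b 0 ≤ M + 2
    change r * δ * ∑ m ∈ Finset.range N, ∑ k ∈ Finset.range (m + 1), b k * b (m - k) ≤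
      r * δ * (∑ m ∈ Finset.range N, b m) ^ 2 at hconv
    linarith

/-- The radius of convergence is positive and finite, and the series diverges there. -/
theorem exists_radius {α : ℝ} (hα : α ∈ Ioo (0 : ℝ) 1) : ∃ R : ℝ, 0 < R ∧
    (∀ r, 0 ≤ r → r < R → Summable fun n => fracCoeff α n * r ^ n) ∧
    ¬ Summable fun n => fracCoeff α n * R ^ n := by
  set S := {r : ℝ | 0 ≤ r ∧ Summable fun n => fracCoeff α n * r ^ n} with hS
  have h0 : (0 : ℝ) ∈ S := by
    refine ⟨le_rfl, summable_of_ne_finset_zero (s := {0}) fun n hn => ?_⟩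
    rw [zero_pow (by simpa using hn), mul_zero]
  have hdown : ∀ r ∈ S, ∀ q, 0 ≤ q → q ≤ r → q ∈ S := fun r hr q hq hqr =>
    ⟨hq, hr.2.of_nonneg_of_le (fun n => mul_nonneg (fracCoeff_pos hα n).le (pow_nonneg hq n))
      fun n => mul_le_mul_of_nonneg_left (pow_le_pow_left₀ hq hqr n) (fracCoeff_pos hα n).le⟩
  have hbdd : BddAbove S := by
    refine ⟨1, fun r hr => ?_⟩
    by_contra! h
    have := hr.2.tendsto_atTop_zero
    obtain ⟨n, hn⟩ := (this.eventually (gt_mem_nhds one_pos)).exists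
    exact absurd hn (not_lt.2 (one_le_mul_of_one_le_of_one_le (one_le_fracCoeff hα n)
      (one_le_pow₀ h.le)))
  obtain ⟨r₁, hr₁, hs₁⟩ := exists_gt_summable hα le_rfl h0.2
  have hpos : 0 < sSup S := hr₁.trans_le (le_csSup hbdd ⟨hr₁.le, hs₁⟩)
  refine ⟨sSup S, hpos, fun r hr hlt => ?_, fun h => ?_⟩
  · obtain ⟨q, hq, hrq⟩ := exists_lt_of_lt_csSup ⟨0, h0⟩ hlt
    exact (hdown q hq r hr hrq.le).2
  · obtain ⟨q, hq, hsq⟩ := exists_gt_summable hα hpos.le h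
    exact absurd (le_csSup hbdd ⟨hpos.le.trans hq.le, hsq⟩) (not_le.2 hq)

theorem integral_rpow_mul_sub_rpow {s r t : ℝ} (hs : 0 < s) (hr : 0 < r) (ht : 0 < t) :
    ∫ x in 0..t, x ^ (s - 1) * (t - x) ^ (r - 1) =
      t ^ (s + r - 1) * (Real.Gamma s * Real.Gamma r / Real.Gamma (s + r)) := by
  have h := Complex.betaIntegral_scaled s r ht
  rw [Complex.betaIntegral_eq_Gamma_mul_div _ _ (by simpa) (by simpa)] at h
  have h2 : ∫ x in 0..t, (x : ℂ) ^ ((s : ℂ) - 1) * ((t : ℂ) - x) ^ ((r : ℂ) - 1) =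
      ∫ x in 0..t, ((x ^ (s - 1) * (t - x) ^ (r - 1) : ℝ) : ℂ) := by
    refine intervalIntegral.integral_congr fun x hx => ?_
    rw [uIcc_of_le ht.le] at hx
    rw [Complex.ofReal_mul, Complex.ofReal_cpow hx.1, Complex.ofReal_cpow (sub_nonneg.2 hx.2)]
    push_cast
    rfl
  rw [h2, intervalIntegral.integral_ofReal] at h
  apply Complex.ofReal_injective
  rw [h]
  push_cast [Complex.ofReal_cpow ht.le, ← Complex.Gamma_ofReal]
  rfl

theorem intervalIntegrable_rpow_mul_sub_rpow {s r t : ℝ} (hs : 0 < s) (hr : 0 < r) (ht : 0 < t) :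
    IntervalIntegrable (fun x => x ^ (s - 1) * (t - x) ^ (r - 1)) volume 0 t := by
  refine intervalIntegral.intervalIntegrable_of_integral_ne_zero ?_
  rw [integral_rpow_mul_sub_rpow hs hr ht]
  have := Real.Gamma_pos_of_pos hs
  have := Real.Gamma_pos_of_pos hr
  have := Real.Gamma_pos_of_pos (add_pos hs hr)
  positivity

/-- The power series `∑ aₙ zⁿ`. -/
noncomputable def fracSeries (α z : ℝ) : ℝ := ∑' n, fracCoeff α n * z ^ n

theorem analyticAt_fracSeries {α R z : ℝ} (hα : α ∈ Ioo (0 : ℝ) 1)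
    (hs : ∀ r, 0 ≤ r → r < R → Summable fun n => fracCoeff α n * r ^ n) (hz : 0 ≤ z)
    (hzR : z < R) : AnalyticAt ℝ (fracSeries α) z := by
  obtain ⟨ρ, hzρ, hρR⟩ := exists_between hzR
  have hρ : 0 < ρ := hz.trans_lt hzρ
  set p := FormalMultilinearSeries.ofScalars ℝ (fracCoeff α) with hp
  let q : NNReal := ⟨ρ, hρ.le⟩
  have hqρ : (q : ℝ) = ρ := rfl
  have hle : (q : ENNReal) ≤ p.radius := by
    refine p.le_radius_of_summable ?_
    simpa [hqρ, hp, FormalMultilinearSeries.ofScalars_norm, abs_of_pos (fracCoeff_pos hα _)] using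
      hs ρ hρ.le hρR
  have hpos : 0 < p.radius := lt_of_lt_of_le (ENNReal.coe_pos.2 (show 0 < q from hρ)) hle
  have hsum : p.sum = fracSeries α := by
    funext x
    exact (FormalMultilinearSeries.ofScalars_sum_eq (fracCoeff α) x).trans rfl
  rw [← hsum]
  refine (p.hasFPowerSeriesOnBall hpos).analyticAt_of_mem ?_
  refine Metric.eball_subset_eball hle ?_
  rw [Metric.eball_coe]
  simpa [hqρ, abs_of_nonneg hz] using hzρ

theorem hasSum_deriv_fracSeries {α R z : ℝ} (hα : α ∈ Ioo (0 : ℝ) 1)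
    (hs : ∀ r, 0 ≤ r → r < R → Summable fun n => fracCoeff α n * r ^ n) (hz : 0 ≤ z)
    (hzR : z < R) :
    HasSum (fun n : ℕ => fracCoeff α (n + 1) * ((n + 1 : ℕ) * z ^ n)) (deriv (fracSeries α) z) := by
  obtain ⟨ρ, hzρ, hρR⟩ := exists_between hzR
  obtain ⟨r, hρr, hrR⟩ := exists_between hρR
  have hρ : 0 < ρ := hz.trans_lt hzρ
  have hr : 0 < r := hρ.trans hρr
  have hbound : Summable fun n : ℕ => fracCoeff α n * (n * ρ ^ (n - 1)) := by
    have ht := tendsto_self_mul_const_pow_of_lt_one (r := ρ / r) (by positivity)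
      ((div_lt_one hr).2 hρr)
    obtain ⟨C, hC⟩ := ht.bddAbove_range
    refine ((hs r hr.le hrR).mul_left (C / ρ)).of_nonneg_of_le
      (fun n => mul_nonneg (fracCoeff_pos hα n).le (by positivity)) fun n => ?_
    have h1 : (n : ℝ) * (ρ / r) ^ n ≤ C := hC ⟨n, rfl⟩
    rw [div_pow, ← mul_div_assoc, div_le_iff₀ (by positivity)] at h1
    have h2 : (n : ℝ) * ρ ^ (n - 1) ≤ C * r ^ n / ρ := by
      rw [le_div_iff₀ hρ]
      cases n with
      | zero => simpa using h1
      | succ n => simpa [pow_succ, mul_assoc] using h1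
    calc _ ≤ fracCoeff α n * (C * r ^ n / ρ) :=
          mul_le_mul_of_nonneg_left h2 (fracCoeff_pos hα n).le
      _ = _ := by ring
  have hterm : ∀ (n : ℕ) (y : ℝ), y ∈ Ioo (-ρ) ρ →
      ‖fracCoeff α n * (n * y ^ (n - 1))‖ ≤ fracCoeff α n * (n * ρ ^ (n - 1)) := fun n y hy => by
    rw [norm_mul, norm_mul, norm_pow, Real.norm_of_nonneg (fracCoeff_pos hα n).le,
      Real.norm_of_nonneg (Nat.cast_nonneg n), Real.norm_eq_abs]
    have := (fracCoeff_pos hα n).le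
    have := (abs_lt.2 hy).le
    gcongr
  have hd : HasDerivAt (fracSeries α) (∑' n : ℕ, fracCoeff α n * (n * z ^ (n - 1))) z :=
    hasDerivAt_tsum_of_isPreconnected hbound isOpen_Ioo isPreconnected_Ioo
      (fun n y _ => (hasDerivAt_pow n y).const_mul (fracCoeff α n)) hterm
      (y₀ := z) ⟨by linarith, hzρ⟩ (hs z hz hzR) ⟨by linarith, hzρ⟩
  have hsum : Summable fun n : ℕ => fracCoeff α n * (n * z ^ (n - 1)) :=
    hbound.of_norm_bounded fun n => hterm n z ⟨by linarith, hzρ⟩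
  rw [hd.deriv]
  have := (hasSum_nat_add_iff' 1).2 hsum.hasSum
  simpa using this

theorem tendsto_fracSeries_atTop {α R : ℝ} (hα : α ∈ Ioo (0 : ℝ) 1) (hR : 0 < R)
    (hs : ∀ r, 0 ≤ r → r < R → Summable fun n => fracCoeff α n * r ^ n)
    (hd : ¬ Summable fun n => fracCoeff α n * R ^ n) :
    Tendsto (fracSeries α) (𝓝[<] R) atTop := by
  refine tendsto_atTop.2 fun C => ?_
  have ht := (not_summable_iff_tendsto_nat_atTop_of_nonneg fun n =>
    mul_nonneg (fracCoeff_pos hα n).le (pow_nonneg hR.le n)).1 hd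
  obtain ⟨N, hN⟩ := (ht.eventually (eventually_gt_atTop C)).exists
  have hcont : Continuous fun r : ℝ => ∑ n ∈ Finset.range N, fracCoeff α n * r ^ n := by fun_prop
  filter_upwards [(hcont.continuousAt.eventually (lt_mem_nhds hN)).filter_mono nhdsWithin_le_nhds,
    (lt_mem_nhds hR).filter_mono nhdsWithin_le_nhds, self_mem_nhdsWithin] with z h1 h2 h3
  exact h1.le.trans ((hs z h2.le h3).sum_le_tsum _ fun n _ =>
    mul_nonneg (fracCoeff_pos hα n).le (pow_nonneg h2.le n))

theorem fracSeries_zero (α : ℝ) : fracSeries α 0 = 1 := by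
  rw [fracSeries, tsum_eq_single 0 fun n hn => by rw [zero_pow hn, mul_zero], fracCoeff_zero]
  simp

theorem hasSum_sq_fracSeries {α R z : ℝ}
    (hs : ∀ r, 0 ≤ r → r < R → Summable fun n => fracCoeff α n * r ^ n) (hz : 0 ≤ z)
    (hzR : z < R) :
    HasSum (fun n => (∑ k ∈ Finset.range (n + 1), fracCoeff α k * fracCoeff α (n - k)) * z ^ n)
      (fracSeries α z ^ 2) := by
  have hsn : Summable fun n => ‖fracCoeff α n * z ^ n‖ := (hs z hz hzR).norm
  have h1 := (summable_norm_sum_mul_antidiagonal_of_summable_norm hsn hsn).of_norm.hasSum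
  rw [← tsum_mul_tsum_eq_tsum_sum_antidiagonal_of_summable_norm hsn hsn, ← sq] at h1
  change HasSum _ ((∑' n, fracCoeff α n * z ^ n) ^ 2)
  refine Eq.mpr (congrArg (HasSum · _) (funext fun n => ?_)) h1
  rw [Finset.Nat.sum_antidiagonal_eq_sum_range_succ
    (fun i j => fracCoeff α i * z ^ i * (fracCoeff α j * z ^ j)), Finset.sum_mul]
  refine Finset.sum_congr rfl fun k hk => ?_
  have : z ^ n = z ^ k * z ^ (n - k) := by
    rw [← pow_add]
    congr 1
    have := Finset.mem_range.1 hk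
    omega
  rw [this]
  ring

/-- The function `t ↦ ∑ aₙ t^(nα)`. -/
noncomputable def fracSolution (α t : ℝ) : ℝ := fracSeries α (t ^ α)

theorem fracSolution_zero {α : ℝ} (hα : α ≠ 0) : fracSolution α 0 = 1 := by
  rw [fracSolution, Real.zero_rpow hα, fracSeries_zero]

theorem contDiffAt_fracSolution {α R t : ℝ} (hα : α ∈ Ioo (0 : ℝ) 1)
    (hs : ∀ r, 0 ≤ r → r < R → Summable fun n => fracCoeff α n * r ^ n) (ht : 0 < t)
    (htR : t ^ α < R) : ContDiffAt ℝ ∞ (fracSolution α) t :=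
  (analyticAt_fracSeries hα hs (by positivity) htR).contDiffAt.comp t
    (contDiffAt_id.rpow_const_of_ne ht.ne')

theorem continuousAt_fracSolution {α R t : ℝ} (hα : α ∈ Ioo (0 : ℝ) 1)
    (hs : ∀ r, 0 ≤ r → r < R → Summable fun n => fracCoeff α n * r ^ n) (ht : 0 ≤ t)
    (htR : t ^ α < R) : ContinuousAt (fracSolution α) t :=
  ContinuousAt.comp (f := fun t : ℝ => t ^ α)
    (analyticAt_fracSeries hα hs (by positivity) htR).continuousAt
    (Real.continuousAt_rpow_const t α (Or.inr hα.1.le))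

theorem hasSum_caputoIntegrand_fracSolution {α R t τ : ℝ} (hα : α ∈ Ioo (0 : ℝ) 1)
    (hs : ∀ r, 0 ≤ r → r < R → Summable fun n => fracCoeff α n * r ^ n) (hτ : τ ∈ Ioo 0 t)
    (htR : t ^ α < R) :
    HasSum (fun n : ℕ => fracCoeff α (n + 1) * ((n + 1 : ℕ) * α) *
      (τ ^ ((n + 1 : ℕ) * α - 1) * (t - τ) ^ ((1 - α) - 1)))
      (caputoIntegrand α (fracSolution α) t τ) := by
  have hτ0 := hτ.1
  have hτR : τ ^ α < R := (Real.rpow_lt_rpow hτ0.le hτ.2 hα.1).trans htR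
  have hz : 0 ≤ τ ^ α := by positivity
  have hd : HasDerivAt (fracSolution α) (deriv (fracSeries α) (τ ^ α) * (α * τ ^ (α - 1))) τ :=
    (analyticAt_fracSeries hα hs hz hτR).differentiableAt.hasDerivAt.comp τ
      (Real.hasDerivAt_rpow_const (Or.inl hτ0.ne'))
  rw [caputoIntegrand, hd.deriv]
  have h := (hasSum_deriv_fracSeries hα hs hz hτR).mul_right
    (α * τ ^ (α - 1) * (t - τ) ^ (-α))
  rw [div_eq_mul_inv, ← Real.rpow_neg (sub_nonneg.2 hτ.2.le), mul_assoc]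
  refine Eq.mpr (congrArg (HasSum · _) (funext fun n => ?_)) h
  have e : τ ^ (((n + 1 : ℕ) : ℝ) * α - 1) = (τ ^ α) ^ n * τ ^ (α - 1) := by
    rw [← Real.rpow_natCast, ← Real.rpow_mul hτ0.le, ← Real.rpow_add hτ0]
    congr 1
    push_cast
    ring
  rw [e, show (1 - α) - 1 = -α by ring]
  ring

theorem integral_term_fracSolution {α t : ℝ} (hα : α ∈ Ioo (0 : ℝ) 1) (ht : 0 < t) (n : ℕ) :
    ∫ τ in 0..t, fracCoeff α (n + 1) * ((n + 1 : ℕ) * α) *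
      (τ ^ ((n + 1 : ℕ) * α - 1) * (t - τ) ^ ((1 - α) - 1)) =
    Real.Gamma (1 - α) *
      ((∑ k ∈ Finset.range (n + 1), fracCoeff α k * fracCoeff α (n - k)) * (t ^ α) ^ n) := by
  have h0 := hα.1
  have hn : 0 < ((n + 1 : ℕ) : ℝ) * α := by positivity
  rw [intervalIntegral.integral_const_mul,
    integral_rpow_mul_sub_rpow hn (by linarith [hα.2]) ht,
    fracCoeff_succ, gammaRatio, Real.Gamma_add_one hn.ne',
    show ((n + 1 : ℕ) : ℝ) * α + (1 - α) = n * α + 1 by push_cast; ring,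
    show (n : ℝ) * α + 1 - 1 = α * n by ring, Real.rpow_mul ht.le, Real.rpow_natCast]
  have h1 := (Real.Gamma_pos_of_pos hn).ne'
  have h2 := (Real.Gamma_pos_of_pos (show (0 : ℝ) < n * α + 1 by positivity)).ne'
  field_simp

theorem integral_caputoIntegrand_fracSolution {α R t : ℝ} (hα : α ∈ Ioo (0 : ℝ) 1)
    (hs : ∀ r, 0 ≤ r → r < R → Summable fun n => fracCoeff α n * r ^ n) (ht : 0 < t)
    (htR : t ^ α < R) :
    ∫ τ in 0..t, caputoIntegrand α (fracSolution α) t τ =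
      Real.Gamma (1 - α) * fracSolution α t ^ 2 := by
  have h0 := hα.1
  set F : ℕ → ℝ → ℝ := fun n τ => fracCoeff α (n + 1) * ((n + 1 : ℕ) * α) *
      (τ ^ ((n + 1 : ℕ) * α - 1) * (t - τ) ^ ((1 - α) - 1)) with hF
  have hint : ∀ n, Integrable (F n) (volume.restrict (Ioc 0 t)) := fun n =>
    ((intervalIntegrable_rpow_mul_sub_rpow (by positivity) (by linarith [hα.2]) ht).const_mul _).1
  have hval := (hasSum_sq_fracSeries hs (by positivity) htR).mul_left (Real.Gamma (1 - α))
  have hI : ∀ n, ∫ τ in Ioc 0 t, F n τ = Real.Gamma (1 - α) *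
      ((∑ k ∈ Finset.range (n + 1), fracCoeff α k * fracCoeff α (n - k)) * (t ^ α) ^ n) :=
    fun n => by
      rw [← intervalIntegral.integral_of_le ht.le]
      exact integral_term_fracSolution hα ht n
  have hnorm : ∀ n, ∫ τ in Ioc 0 t, ‖F n τ‖ = ∫ τ in Ioc 0 t, F n τ := fun n =>
    setIntegral_congr_fun measurableSet_Ioc fun τ hτ => by
      refine Real.norm_of_nonneg ?_
      have h1 := (fracCoeff_pos hα (n + 1)).le
      have h2 := hτ.1.le
      have h3 := sub_nonneg.2 hτ.2
      positivity
  have hswap := hasSum_integral_of_summable_integral_norm hint (by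
    simp_rw [hnorm, hI]
    exact hval.summable)
  simp_rw [hI] at hswap
  rw [intervalIntegral.integral_of_le ht.le, show fracSolution α t = fracSeries α (t ^ α) from rfl,
    hval.unique hswap, integral_Ioc_eq_integral_Ioo, integral_Ioc_eq_integral_Ioo]
  exact setIntegral_congr_fun measurableSet_Ioo fun τ hτ =>
    (hasSum_caputoIntegrand_fracSolution hα hs hτ htR).tsum_eq.symm

theorem fracSolution_pos {α R t : ℝ} (hα : α ∈ Ioo (0 : ℝ) 1)
    (hs : ∀ r, 0 ≤ r → r < R → Summable fun n => fracCoeff α n * r ^ n) (ht : 0 ≤ t)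
    (htR : t ^ α < R) : 0 < fracSolution α t :=
  (hs _ (by positivity) htR).tsum_pos (fun n => mul_nonneg (fracCoeff_pos hα n).le (by positivity))
    0 (by simp [fracCoeff_zero])

theorem caputoDifferentiableAt_fracSolution {α R t : ℝ} (hα : α ∈ Ioo (0 : ℝ) 1)
    (hs : ∀ r, 0 ≤ r → r < R → Summable fun n => fracCoeff α n * r ^ n) (ht : 0 < t)
    (htR : t ^ α < R) : CaputoDifferentiableAt α 0 (fracSolution α) t where
  continuousOn τ hτ := (continuousAt_fracSolution hα hs hτ.1
    ((Real.rpow_le_rpow hτ.1 hτ.2 hα.1.le).trans_lt htR)).continuousWithinAt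
  differentiableOn τ hτ := ((contDiffAt_fracSolution hα hs hτ.1
    ((Real.rpow_lt_rpow hτ.1.le hτ.2 hα.1).trans htR)).differentiableAt
      (by simp)).differentiableWithinAt
  integrable := by
    refine intervalIntegral.intervalIntegrable_of_integral_ne_zero ?_
    rw [integral_caputoIntegrand_fracSolution hα hs ht htR]
    have := fracSolution_pos hα hs ht.le htR
    have := Real.Gamma_pos_of_pos (sub_pos.2 hα.2)
    positivity

theorem caputoDeriv_fracSolution {α R t : ℝ} (hα : α ∈ Ioo (0 : ℝ) 1)
    (hs : ∀ r, 0 ≤ r → r < R → Summable fun n => fracCoeff α n * r ^ n) (ht : 0 < t)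
    (htR : t ^ α < R) : caputoDeriv α 0 (fracSolution α) t = fracSolution α t ^ 2 := by
  have := (Real.Gamma_pos_of_pos (sub_pos.2 hα.2)).ne'
  rw [caputoDeriv, integral_caputoIntegrand_fracSolution hα hs ht htR]
  field_simp

theorem caputoIntegrand_const_mul (α c : ℝ) (f : ℝ → ℝ) (t : ℝ) :
    caputoIntegrand α (fun s => c * f s) t = fun τ => c * caputoIntegrand α f t τ := by
  funext τ
  rw [caputoIntegrand, caputoIntegrand, deriv_const_mul_field, mul_div_assoc]

theorem caputoDeriv_const_mul (α t₀ c : ℝ) (f : ℝ → ℝ) (t : ℝ) :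
    caputoDeriv α t₀ (fun s => c * f s) t = c * caputoDeriv α t₀ f t := by
  rw [caputoDeriv, caputoDeriv, caputoIntegrand_const_mul, intervalIntegral.integral_const_mul]
  ring

theorem CaputoDifferentiableAt.const_mul {α t₀ t : ℝ} {f : ℝ → ℝ}
    (h : CaputoDifferentiableAt α t₀ f t) (c : ℝ) :
    CaputoDifferentiableAt α t₀ (fun s => c * f s) t where
  continuousOn := continuousOn_const.mul h.continuousOn
  differentiableOn := h.differentiableOn.const_mul c
  integrable := by
    rw [caputoIntegrand_const_mul]
    exact h.integrable.const_mul c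

theorem deriv_neg_mul_const (c x : ℝ) : deriv (fun y : ℝ => -y * c) x = -c := by
  have h : HasDerivAt (fun y : ℝ => -y * c) (-1 * c) x := (hasDerivAt_id x).neg.mul_const c
  rw [h.deriv, neg_one_mul]

theorem continuousOn_iteratedDeriv_neg_mul {v : ℝ → ℝ} {s : Set ℝ} (hv : ContinuousOn v s) (k : ℕ) :
    ContinuousOn (fun p : ℝ × ℝ => iteratedDeriv k (fun y => -y * v p.2) p.1) (univ ×ˢ s) := by
  have hv2 : ContinuousOn (fun p : ℝ × ℝ => v p.2) (univ ×ˢ s) :=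
    hv.comp continuousOn_snd fun p hp => hp.2
  match k with
  | 0 =>
    simp only [iteratedDeriv_zero]
    exact continuousOn_fst.neg.mul hv2
  | 1 =>
    simp only [iteratedDeriv_one, deriv_neg_mul_const]
    exact hv2.neg
  | k + 2 =>
    have : ∀ c : ℝ, iteratedDeriv (k + 2) (fun y : ℝ => -y * c) = 0 := fun c => by
      rw [iteratedDeriv_succ', funext (deriv_neg_mul_const c)]
      funext x
      simp [iteratedDeriv_const]
    simp only [this]
    exact continuousOn_const

theorem isSmoothFractionalBurgersSolution_neg_mul {α T : ℝ} {v : ℝ → ℝ}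
    (hv : SolvesCaputoODE α T v) (hc : ContinuousOn v (Ico 0 T))
    (hsm : ContDiffOn ℝ ∞ v (Ioo 0 T)) :
    IsSmoothFractionalBurgersSolution α T (fun x => -x) fun x t => -x * v t where
  smooth := contDiff_fst.contDiffOn.neg.mul (hsm.comp contDiff_snd.contDiffOn fun p hp => hp.2)
  continuous_derivs := continuousOn_iteratedDeriv_neg_mul hc
  caputo x t ht := (hv.caputo t ht).const_mul (-x)
  eqn x t ht := by
    rw [caputoDeriv_const_mul, hv.eqn t ht, deriv_neg_mul_const]
    ring
  init x := by simp [hv.init]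

theorem theorem1 (α : ℝ) (hα : α ∈ Ioo (0 : ℝ) 1) :
    ∃ (T : ℝ) (u₀ : ℝ → ℝ) (u : ℝ → ℝ → ℝ) (v : ℝ → ℝ) (s : ℕ → ℝ),
      0 < T ∧
      ContDiff ℝ ∞ u₀ ∧
      IsSmoothFractionalBurgersSolution α T u₀ u ∧
      SolvesCaputoODE α T v ∧
      (∀ x : ℝ, ∀ t ∈ Ico 0 T, u x t = -x * v t) ∧
      StrictMono s ∧ (∀ n, s n ∈ Ioo 0 T) ∧ Tendsto s atTop (𝓝 T) ∧
      (∀ x : ℝ, x < 0 → Tendsto (fun n => u x (s n)) atTop atTop) ∧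
      (∀ x : ℝ, 0 < x → Tendsto (fun n => u x (s n)) atTop atBot) := by
  obtain ⟨R, hR, hs, hd⟩ := exists_radius hα
  set T := R ^ α⁻¹ with hT
  have hT0 : 0 < T := by positivity
  have hTR : T ^ α = R := Real.rpow_inv_rpow hR.le hα.1.ne'
  have hlt : ∀ t, 0 ≤ t → t < T → t ^ α < R := fun t h0 h1 =>
    hTR ▸ Real.rpow_lt_rpow h0 h1 hα.1
  have hv : SolvesCaputoODE α T (fracSolution α) :=
    ⟨fracSolution_zero hα.1.ne',
      fun t ht => caputoDifferentiableAt_fracSolution hα hs ht.1 (hlt t ht.1.le ht.2),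
      fun t ht => caputoDeriv_fracSolution hα hs ht.1 (hlt t ht.1.le ht.2)⟩
  obtain ⟨s, hmono, hmem, hlim⟩ := exists_seq_strictMono_tendsto' hT0
  have hpow : Tendsto (fun n => s n ^ α) atTop (𝓝[<] R) := by
    refine tendsto_nhdsWithin_iff.2 ⟨?_, Eventually.of_forall fun n =>
      hlt _ (hmem n).1.le (hmem n).2⟩
    rw [← hTR]
    exact hlim.rpow_const (Or.inr hα.1.le)
  have hblow : Tendsto (fun n => fracSolution α (s n)) atTop atTop :=
    (tendsto_fracSeries_atTop hα hR hs hd).comp hpow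
  refine ⟨T, fun x => -x, fun x t => -x * fracSolution α t, fracSolution α, s, hT0, contDiff_neg,
    isSmoothFractionalBurgersSolution_neg_mul hv
      (fun t ht => (continuousAt_fracSolution hα hs ht.1 (hlt t ht.1 ht.2)).continuousWithinAt)
      fun t ht => (contDiffAt_fracSolution hα hs ht.1 (hlt t ht.1.le ht.2)).contDiffWithinAt,
    hv, fun _ _ _ => rfl, hmono, hmem, hlim, fun x hx => ?_, fun x hx => ?_⟩
  · exact hblow.const_mul_atTop (neg_pos.2 hx)
  · exact hblow.const_mul_atTop_of_neg (neg_neg_of_pos hx)
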